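/- Let $A\in\mathbb R^{n\times n}$, $G\in\mathbb R^{n\times m}$ and $\bar c_1,\dots,\bar c_N\in\mathbb R^{n\times p}$, and consider the linear stochastic system $dx=Ax\,dt+G\,dw$ whose state is measured by $N$ sensors with outputs $y_i=\bar c_i^\top x+v_i$ (unit-covariance Gaussian noise). Put $\bar c:=[\bar c_1,\dots,\bar c_N]\in\mathbb R^{n\times Np}$. A period $\tau>0$ is divided into $r_{\rm tot}$ slots of equal length $\tau_0=\tau/r_{\rm tot}$. An allocation strategy is a vector $R=(R_1,\dots,R_{r_{\rm tot}})\in\{1,\dots,N\}^{r_{\rm tot}}$ in which every $i\in\{1,\dots,N\}$ occurs at least $r_{\min}$ times, where $r_{\min}\ge 1$ is a fixed integer; sensor $R_l$ is used in slot $l$, in every period. The error covariance of the optimal (Kalman) estimate is updated over one slot in which sensor $i$ is used by $$\phi_i(\Sigma):=\Big(\big(\Sigma^{-}\big)^{-1}+\bar c_i\bar c_i^\top\Big)^{-1},\qquad \Sigma^-:=e^{A\tau_0}\,\Sigma\, e^{A^\top\tau_0}+\int_0^{\tau_0}e^{As}GG^\top e^{A^\top s}\,ds,$$ and over one period by $\Phi_R:=\phi_{R_{r_{\rm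 tot}}}\circ\cdots\circ\phi_{R_1}$. Let $$\mathcal T:=\{\tau>0 \;:\; e^{\lambda\tau}\neq e^{\mu\tau}\ \text{for all distinct complex eigenvalues } \lambda\ne\mu \text{ of } A\}.$$ Suppose that $(A,\bar c)$ is observable, i.e. the matrix with the blocks $\bar c^\top,\bar c^\top A,\dots,\bar c^\top A^{n-1}$ stacked has rank $n$. Then, for every allocation strategy $R$ and every $\tau\in\mathcal T$, there is a matrix $\Sigma(\infty;\tau,R)$ such that $$\lim_{k\to\infty}\Phi_R^k(\Sigma(0))=\Sigma(\infty;\tau,R)$$ for every initial error covariance $\Sigma(0)$, that is, for every symmetric positive semidefinite $\Sigma(0)\in\mathbb R^{n\times n}$ for which the recursion is defined, meaning that $\Sigma(0)^-=e^{A\tau_0}\Sigma(0)e^{A^\top\tau_0}+\int_0^{\tau_0}e^{As}GG^\top e^{A^\top s}ds$ is invertible (then all later inverses exist as well). In particular the limit depends on $\tau$ and $R$ (and on the system), but not on $\Sigma(0)$. The condition on $\Sigma(0)$ holds for every positive definite $\Sigma(0)$, and for every positive semidefinite $\Sigma(0)$ if $(A,G)$ is controllable. -/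

import Mathlib

open Filter Topology

noncomputable section

namespace SampledEstimation

/-- The observability matrix of the pair `(A, c)`, for the output `y = cᵀ x`: the rows of
`cᵀ, cᵀ A, …, cᵀ A ^ (n - 1)` stacked on top of each other. -/
def observabilityMatrix {n : ℕ} {κ : Type*} (A : Matrix (Fin n) (Fin n) ℝ)
    (c : Matrix (Fin n) κ ℝ) : Matrix (Fin n × κ) (Fin n) ℝ :=
  Matrix.of fun kj i => (c.transpose * A ^ (kj.1 : ℕ)) kj.2 i

/-- The pair `(A, c)` is observable (output `y = cᵀ x`): its observability matrix has rank `n`. -/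
def IsObservable {n : ℕ} {κ : Type*} (A : Matrix (Fin n) (Fin n) ℝ)
    (c : Matrix (Fin n) κ ℝ) : Prop :=
  (observabilityMatrix A c).rank = n

/-- The block matrix `[c₁, …, c_N]`. -/
def concatSensors {n p N : ℕ} (c : Fin N → Matrix (Fin n) (Fin p) ℝ) :
    Matrix (Fin n) (Fin N × Fin p) ℝ :=
  Matrix.of fun a ij => c ij.1 a ij.2

/-- The set of periods `τ > 0` with `exp (λ τ) ≠ exp (μ τ)` for any two distinct complex
eigenvalues `λ, μ` of the real matrix `A`. -/
def nonAliasingPeriods {n : ℕ} (A : Matrix (Fin n) (Fin n) ℝ) : Set ℝ :=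
  {τ | 0 < τ ∧ ∀ z ∈ spectrum ℂ (A.map (algebraMap ℝ ℂ)),
    ∀ w ∈ spectrum ℂ (A.map (algebraMap ℝ ℂ)),
      z ≠ w → Complex.exp (z * (τ : ℂ)) ≠ Complex.exp (w * (τ : ℂ))}

/-- The strategy set: assignments of the `r` time slots of a period to the `N` sensors in which
each sensor receives at least `rmin` slots. -/
def strategySet (N r rmin : ℕ) : Set (Fin r → Fin N) :=
  {R | ∀ i, rmin ≤ (Finset.univ.filter fun l => R l = i).card}

/-- `∫₀ᵗ exp (s A) G Gᵀ exp (s Aᵀ) ds`, entry by entry. -/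
def noiseCov {n m : ℕ} (A : Matrix (Fin n) (Fin n) ℝ) (G : Matrix (Fin n) (Fin m) ℝ) (t : ℝ) :
    Matrix (Fin n) (Fin n) ℝ :=
  Matrix.of fun i j => ∫ s in (0 : ℝ)..t,
    (NormedSpace.exp (s • A) * (G * G.transpose) * NormedSpace.exp (s • A.transpose)) i j

/-- The error covariance just before a measurement, a time `t` after the covariance was `S`. -/
def predictCov {n m : ℕ} (A : Matrix (Fin n) (Fin n) ℝ) (G : Matrix (Fin n) (Fin m) ℝ) (t : ℝ)
    (S : Matrix (Fin n) (Fin n) ℝ) : Matrix (Fin n) (Fin n) ℝ :=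
  NormedSpace.exp (t • A) * S * NormedSpace.exp (t • A.transpose) + noiseCov A G t

/-- The covariance update over one time slot of length `t`, with a measurement by the sensor with
output matrix `cᵀ` at its end. -/
def slotUpdate {n m p : ℕ} (A : Matrix (Fin n) (Fin n) ℝ) (G : Matrix (Fin n) (Fin m) ℝ) (t : ℝ)
    (c : Matrix (Fin n) (Fin p) ℝ) (S : Matrix (Fin n) (Fin n) ℝ) : Matrix (Fin n) (Fin n) ℝ :=
  ((predictCov A G t S)⁻¹ + c * c.transpose)⁻¹

/-- The covariance update over one period `τ`, divided into `r` slots of length `τ / r`: the slot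
updates for the sensors `R 0, R 1, …, R (r - 1)`, applied in this order. -/
def periodUpdate {n m p N r : ℕ} (A : Matrix (Fin n) (Fin n) ℝ) (G : Matrix (Fin n) (Fin m) ℝ)
    (c : Fin N → Matrix (Fin n) (Fin p) ℝ) (τ : ℝ) (R : Fin r → Fin N)
    (S : Matrix (Fin n) (Fin n) ℝ) : Matrix (Fin n) (Fin n) ℝ :=
  (List.ofFn R).foldl (fun S' i => slotUpdate A G (τ / r) (c i) S') S

end SampledEstimation

end

/-!
Over `n + 1` periods the filter acts on positive definite covariances as a Riccati map
`X ↦ Q + F (X⁻¹ + J)⁻¹ Fᴴ`, where the kernel of the information matrix `J` consists of the initial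
states whose sampled outputs all vanish. If there were such a state, the space of all of them
would contain an eigenvector of `exp (τ A)`. Because `exp` is injective on the spectrum of `τ A`, it
would be an eigenvector of `A`, and a sample by sensor `i` would then see it up to a nonzero scalar
as `cᵢᵀ` does, contradicting observability. So `J` is positive definite.

Such a Riccati map is monotone and bounded by `Q + F J⁻¹ Fᴴ`, and its iterates from there decrease
to a fixed point `P`. On the ray `e • P`, `0 ≤ e ≤ 1`, it is more than homogeneous with a definite
gain, so the iterates of any `X ≥ e • P` with `e > 0` are squeezed to `P`.
-/

namespace SampledEstimation

open Matrix
open scoped MatrixOrder ComplexOrder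

section PosteriorCovariance

variable {𝕜 ι κ : Type*} [RCLike 𝕜] [Fintype ι] [DecidableEq ι] [Fintype κ] [DecidableEq κ]

/-- The covariance after a measurement with information matrix `C` (that is, `C = H Hᴴ` for the
output `Hᴴ x` with unit noise) when it was `P` before. For invertible `P` this is
`(P⁻¹ + C)⁻¹`; the form chosen here also makes sense for singular `P`. -/
noncomputable def posteriorCov (P C : Matrix ι ι 𝕜) : Matrix ι ι 𝕜 := (1 + P * C)⁻¹ * P

variable {P Q X C C₁ C₂ J : Matrix ι ι 𝕜}

lemma isUnit_one_add_mul (hP : P.PosSemidef) (hC : C.PosSemidef) : IsUnit (1 + P * C) := by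
  obtain ⟨B, rfl⟩ := CStarAlgebra.nonneg_iff_eq_star_mul_self.mp hC.nonneg
  have hB : (1 + B * P * Bᴴ).PosDef := PosDef.one.add_posSemidef (hP.mul_mul_conjTranspose_same B)
  rw [isUnit_iff_isUnit_det, star_eq_conjTranspose, ← Matrix.mul_assoc, det_one_add_mul_comm,
    ← Matrix.mul_assoc]
  exact hB.isUnit.map detMonoidHom

lemma one_add_mul_mul_posteriorCov (hP : P.PosSemidef) (hC : C.PosSemidef) :
    (1 + P * C) * posteriorCov P C = P :=
  mul_nonsing_inv_cancel_left _ _ ((isUnit_iff_isUnit_det _).mp (isUnit_one_add_mul hP hC))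

lemma posteriorCov_eq_of_one_add_mul_mul_eq (hP : P.PosSemidef) (hC : C.PosSemidef)
    (h : (1 + P * C) * X = P) : posteriorCov P C = X :=
  (isUnit_one_add_mul hP hC).mul_left_cancel ((one_add_mul_mul_posteriorCov hP hC).trans h.symm)

lemma posteriorCov_eq_inv (hP : IsUnit P) (C : Matrix ι ι 𝕜) :
    posteriorCov P C = (P⁻¹ + C)⁻¹ := by
  have hdet := (isUnit_iff_isUnit_det P).mp hP
  have : P⁻¹ + C = P⁻¹ * (1 + P * C) := by
    rw [mul_add, mul_one, nonsing_inv_mul_cancel_left P C hdet]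
  rw [this, Matrix.mul_inv_rev, nonsing_inv_nonsing_inv P hdet, posteriorCov]

@[simp]
lemma posteriorCov_zero_right (P : Matrix ι ι 𝕜) : posteriorCov P 0 = P := by
  simp [posteriorCov]

lemma posteriorCov_mul_mul_conjTranspose {Z : Matrix κ κ 𝕜} (hZ : Z.PosSemidef)
    (hC : C.PosSemidef) (F : Matrix ι κ 𝕜) :
    posteriorCov (F * Z * Fᴴ) C = F * posteriorCov Z (Fᴴ * C * F) * Fᴴ := by
  refine posteriorCov_eq_of_one_add_mul_mul_eq (hZ.mul_mul_conjTranspose_same F) hC ?_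
  calc (1 + F * Z * Fᴴ * C) * (F * posteriorCov Z (Fᴴ * C * F) * Fᴴ)
      = F * ((1 + Z * (Fᴴ * C * F)) * posteriorCov Z (Fᴴ * C * F)) * Fᴴ := by
        simp only [Matrix.add_mul, Matrix.mul_add, Matrix.one_mul, Matrix.mul_assoc]
    _ = F * Z * Fᴴ := by
        rw [one_add_mul_mul_posteriorCov hZ (hC.conjTranspose_mul_mul_same F)]

lemma posSemidef_posteriorCov (hP : P.PosSemidef) (hC : C.PosSemidef) :
    (posteriorCov P C).PosSemidef := by
  obtain ⟨B, hB⟩ := CStarAlgebra.nonneg_iff_eq_star_mul_self.mp hP.nonneg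
  have hP' : P = Bᴴ * 1 * Bᴴᴴ := by simpa [star_eq_conjTranspose] using hB
  rw [hP', posteriorCov_mul_mul_conjTranspose .one hC, posteriorCov_eq_inv isUnit_one, inv_one]
  exact (PosDef.one.add_posSemidef
    (hC.conjTranspose_mul_mul_same Bᴴ)).inv.posSemidef.mul_mul_conjTranspose_same Bᴴ

lemma posteriorCov_mul_one_add_mul (hP : P.PosSemidef) (hC : C.PosSemidef) :
    posteriorCov P C * (1 + C * P) = P := by
  have h := congrArg conjTranspose (one_add_mul_mul_posteriorCov hP hC)
  simpa [(posSemidef_posteriorCov hP hC).isHermitian.eq, hP.isHermitian.eq,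
    hC.isHermitian.eq] using h

lemma posteriorCov_posteriorCov (hP : P.PosSemidef) (hC₁ : C₁.PosSemidef)
    (hC₂ : C₂.PosSemidef) :
    posteriorCov (posteriorCov P C₁) C₂ = posteriorCov P (C₁ + C₂) := by
  refine (posteriorCov_eq_of_one_add_mul_mul_eq hP (hC₁.add hC₂) ?_).symm
  have h₁ := one_add_mul_mul_posteriorCov hP hC₁
  have h₂ := one_add_mul_mul_posteriorCov (posSemidef_posteriorCov hP hC₁) hC₂
  set S := posteriorCov P C₁
  calc (1 + P * (C₁ + C₂)) * posteriorCov S C₂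
      = ((1 + P * C₁) + P * C₂) * posteriorCov S C₂ := by rw [mul_add, add_assoc]
    _ = (1 + P * C₁) * ((1 + S * C₂) * posteriorCov S C₂) := by
        nth_rw 2 [← h₁]; noncomm_ring
    _ = P := by rw [h₂, h₁]

lemma one_add_mul_mul_one_sub (hQ : Q.PosSemidef) (hC : C.PosSemidef) :
    (1 + Q * C) * (1 - Q * posteriorCov C Q) = 1 :=
  calc (1 + Q * C) * (1 - Q * posteriorCov C Q)
      = 1 + Q * (C - (1 + C * Q) * posteriorCov C Q) := by noncomm_ring
    _ = 1 := by rw [one_add_mul_mul_posteriorCov hC hQ, sub_self, mul_zero, add_zero]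

/-- When the measurement with information `C` also has to resolve the error `Q`, only the
information `posteriorCov C Q` is left about the error `X`. -/
lemma posteriorCov_add (hQ : Q.PosSemidef) (hX : X.PosSemidef) (hC : C.PosSemidef) :
    posteriorCov (Q + X) C = posteriorCov Q C + (1 - Q * posteriorCov C Q) *
      posteriorCov X (posteriorCov C Q) * (1 - Q * posteriorCov C Q)ᴴ := by
  refine posteriorCov_eq_of_one_add_mul_mul_eq (hQ.add hX) hC ?_
  have hK := posSemidef_posteriorCov hC hQ
  have hKC := posteriorCov_mul_one_add_mul hC hQ
  have hM := one_add_mul_mul_one_sub hQ hC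
  have hMadj : (1 - Q * posteriorCov C Q)ᴴ = 1 - posteriorCov C Q * Q := by
    simp [hQ.isHermitian.eq, hK.isHermitian.eq]
  rw [hMadj]
  set K := posteriorCov C Q
  have hsplit : 1 + (Q + X) * C = (1 + X * K) * (1 + Q * C) := by
    rw [add_mul 1 (X * K), one_mul, mul_assoc, hKC]; noncomm_ring
  calc (1 + (Q + X) * C) * (posteriorCov Q C +
        (1 - Q * K) * posteriorCov X K * (1 - K * Q))
      = (1 + X * K) * (1 + Q * C) * (posteriorCov Q C +
        (1 - Q * K) * posteriorCov X K * (1 - K * Q)) := by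
        rw [hsplit]
    _ = (1 + X * K) * ((1 + Q * C) * posteriorCov Q C) +
        (1 + X * K) * ((1 + Q * C) * (1 - Q * K)) * posteriorCov X K * (1 - K * Q) := by
        noncomm_ring
    _ = Q + X * K * Q + (1 + X * K) * posteriorCov X K * (1 - K * Q) := by
        rw [one_add_mul_mul_posteriorCov hQ hC, hM]; noncomm_ring
    _ = Q + X := by rw [one_add_mul_mul_posteriorCov hX hK]; noncomm_ring

lemma posteriorCov_mono_left (hP : P.PosSemidef) (hPX : P ≤ X) (hC : C.PosSemidef) :
    posteriorCov P C ≤ posteriorCov X C := by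
  obtain ⟨Y, rfl⟩ : ∃ Y, X = P + Y := ⟨X - P, (add_sub_cancel _ _).symm⟩
  have hY : Y.PosSemidef := by simpa [le_iff] using hPX
  rw [posteriorCov_add hP hY hC, le_iff, add_sub_cancel_left]
  exact (posSemidef_posteriorCov hY (posSemidef_posteriorCov hC hP)).mul_mul_conjTranspose_same _

lemma posteriorCov_le_inv (hX : X.PosSemidef) (hJ : J.PosDef) : posteriorCov X J ≤ J⁻¹ := by
  have hJXJ : (J * X * J).PosSemidef := by
    simpa [hJ.isHermitian.eq] using hX.mul_mul_conjTranspose_same J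
  have hdet := (isUnit_iff_isUnit_det J).mp hJ.isUnit
  have h : posteriorCov X J = J⁻¹ - posteriorCov J⁻¹ (J * X * J) := by
    refine posteriorCov_eq_of_one_add_mul_mul_eq hX hJ.posSemidef ?_
    have := one_add_mul_mul_posteriorCov hJ.inv.posSemidef hJXJ
    rw [← mul_assoc, nonsing_inv_mul_cancel_left _ _ hdet] at this
    rw [mul_sub, this, add_mul, one_mul, mul_assoc, mul_nonsing_inv J hdet, mul_one,
      add_sub_cancel_left]
  rw [h, le_iff, sub_sub_cancel]
  exact posSemidef_posteriorCov hJ.inv.posSemidef hJXJ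

lemma posteriorCov_smul_left {e : ℝ} (he : 0 ≤ e) (hX : X.PosSemidef) (hC : C.PosSemidef) :
    posteriorCov (e • X) C = e • posteriorCov X (e • C) := by
  refine posteriorCov_eq_of_one_add_mul_mul_eq (hX.smul he) hC ?_
  have h := one_add_mul_mul_posteriorCov hX (hC.smul he)
  rw [Matrix.mul_smul, ← Matrix.smul_mul] at h
  rw [Matrix.mul_smul, h]

lemma posteriorCov_add_mul_mul_le (hP : P.PosSemidef) (hC : C.PosSemidef) :
    posteriorCov P C + posteriorCov P C * C * posteriorCov P C ≤ P := by
  have hS := posSemidef_posteriorCov hP hC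
  have h₁ := one_add_mul_mul_posteriorCov hP hC
  have h₂ := posteriorCov_mul_one_add_mul hP hC
  set S := posteriorCov P C
  have h : P - (S + S * C * S) = (S * C) * P * (S * C)ᴴ := by
    have hPS : P - S = S * C * P := by rw [sub_eq_iff_eq_add]; nth_rw 1 [← h₂]; noncomm_ring
    have hSP : P - S = P * C * S := by rw [sub_eq_iff_eq_add]; nth_rw 1 [← h₁]; noncomm_ring
    rw [conjTranspose_mul, hS.isHermitian.eq, hC.isHermitian.eq]
    calc P - (S + S * C * S) = S * C * (P - S) := by rw [mul_sub, ← sub_sub, hPS]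
      _ = S * C * P * (C * S) := by rw [hSP]; noncomm_ring
  rw [le_iff, h]
  exact hP.mul_mul_conjTranspose_same _

/-- Since `posteriorCov (e • P) C = e • posteriorCov P (e • C)`, scaling the prior amounts to
leaving out the information `(1 - e) • C`, and this accounts for the second-order term. -/
lemma smul_posteriorCov_add_le {e : ℝ} (he₀ : 0 ≤ e) (he₁ : e ≤ 1) (hP : P.PosSemidef)
    (hC : C.PosSemidef) :
    e • (posteriorCov P C + (1 - e) • (posteriorCov P C * C * posteriorCov P C)) ≤
      posteriorCov (e • P) C := by
  have hU := posSemidef_posteriorCov hP (hC.smul he₀)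
  have hC' := hC.smul (sub_nonneg.mpr he₁)
  have hsplit : e • C + (1 - e) • C = C := by rw [← add_smul, add_sub_cancel, one_smul]
  have h := posteriorCov_add_mul_mul_le hU hC'
  rw [posteriorCov_posteriorCov hP (hC.smul he₀) hC', hsplit, Matrix.mul_smul,
    Matrix.smul_mul] at h
  rw [posteriorCov_smul_left he₀ hP hC]
  exact smul_le_smul_of_nonneg_left h he₀

end PosteriorCovariance

section LoewnerOrder

variable {𝕜 ι : Type*} [RCLike 𝕜] {A P X S J : Matrix ι ι 𝕜}

lemma norm_apply_le_re_trace [Fintype ι] (hA : A.PosSemidef) (i j : ι) :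
    ‖A i j‖ ≤ RCLike.re A.trace := by
  classical
  obtain ⟨B, rfl⟩ := CStarAlgebra.nonneg_iff_eq_star_mul_self.mp hA.nonneg
  have hsq (k l : ι) : ‖B k l‖ ^ 2 ≤ ∑ l, ‖B k l‖ ^ 2 :=
    Finset.single_le_sum (f := fun l => ‖B k l‖ ^ 2) (fun _ _ => sq_nonneg _) (Finset.mem_univ l)
  have htrace : RCLike.re (star B * B).trace = ∑ k, ∑ l, ‖B k l‖ ^ 2 := by
    rw [Finset.sum_comm]
    simp only [trace, diag_apply, mul_apply, star_apply, RCLike.star_def, RCLike.conj_mul,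
      map_sum, ← RCLike.ofReal_pow, RCLike.ofReal_re]
  calc ‖(star B * B) i j‖ = ‖∑ k, star (B k i) * B k j‖ := rfl
    _ ≤ ∑ k, ‖star (B k i) * B k j‖ := norm_sum_le _ _
    _ ≤ ∑ k, ∑ l, ‖B k l‖ ^ 2 := by
        refine Finset.sum_le_sum fun k _ => ?_
        rw [norm_mul, norm_star]
        nlinarith [hsq k i, hsq k j, sq_nonneg (‖B k i‖ - ‖B k j‖)]
    _ = RCLike.re (star B * B).trace := htrace.symm

lemma re_trace_mono [Fintype ι] :
    Monotone fun A : Matrix ι ι 𝕜 => RCLike.re A.trace := fun A B h => by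
  have := (RCLike.nonneg_iff.mp (le_iff.mp h).trace_nonneg).1
  simpa [trace_sub] using this

lemma continuous_re_trace [Fintype ι] : Continuous fun A : Matrix ι ι 𝕜 => RCLike.re A.trace :=
  RCLike.continuous_re.comp continuous_id.matrix_trace

lemma tendsto_of_le_of_le [Finite ι] {f g h : ℕ → Matrix ι ι 𝕜} (hfg : ∀ k, f k ≤ g k)
    (hgh : ∀ k, g k ≤ h k) (hf : Tendsto f atTop (𝓝 P)) (hh : Tendsto h atTop (𝓝 P)) :
    Tendsto g atTop (𝓝 P) := by
  cases nonempty_fintype ι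
  have htrace : Tendsto (fun k => RCLike.re (h k - f k).trace) atTop (𝓝 0) := by
    simpa only [Function.comp_def, sub_self, trace_zero, map_zero] using
      (continuous_re_trace.tendsto _).comp (hh.sub hf)
  have hgf : Tendsto (fun k => g k - f k) atTop (𝓝 0) :=
    tendsto_pi_nhds.mpr fun i => tendsto_pi_nhds.mpr fun j =>
      squeeze_zero_norm (fun k => (norm_apply_le_re_trace (hfg k) i j).trans
        (re_trace_mono (sub_le_sub_right (hgh k) (f k)))) htrace
  simpa using hgf.add hf

lemma isClosed_setOf_posSemidef [Finite ι] :
    IsClosed {A : Matrix ι ι 𝕜 | A.PosSemidef} := by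
  cases nonempty_fintype ι
  have : {A : Matrix ι ι 𝕜 | A.PosSemidef} =
      {A | Aᴴ = A} ∩ ⋂ x : ι → 𝕜, {A | 0 ≤ star x ⬝ᵥ (A *ᵥ x)} := by
    ext A; simp [posSemidef_iff_dotProduct_mulVec, IsHermitian]
  rw [this]
  exact (isClosed_eq (by fun_prop) continuous_id).inter <| isClosed_iInter fun x =>
    isClosed_le continuous_const (by fun_prop)

lemma exists_tendsto_of_antitone [Finite ι] {f : ℕ → Matrix ι ι 𝕜} (hf : Antitone f)
    (hpos : ∀ k, (f k).PosSemidef) : ∃ P, P.PosSemidef ∧ Tendsto f atTop (𝓝 P) := by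
  cases nonempty_fintype ι
  set m := ⨅ k, RCLike.re (f k).trace
  have hbdd : BddBelow (Set.range fun k => RCLike.re (f k).trace) :=
    ⟨0, Set.forall_mem_range.mpr fun k => (RCLike.nonneg_iff.mp (hpos k).trace_nonneg).1⟩
  have htrace : Tendsto (fun k => RCLike.re (f k).trace - m) atTop (𝓝 0) := by
    rw [← sub_self m]
    exact (tendsto_atTop_ciInf (re_trace_mono.comp_antitone hf) hbdd).sub_const m
  have hcauchy (i j : ι) : CauchySeq fun k => f k i j := by
    refine cauchySeq_of_le_tendsto_0' _ (fun k l hkl => ?_) htrace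
    calc dist (f k i j) (f l i j) = ‖(f k - f l) i j‖ := dist_eq_norm _ _
      _ ≤ RCLike.re (f k - f l).trace := norm_apply_le_re_trace (hf hkl) i j
      _ = RCLike.re (f k).trace - RCLike.re (f l).trace := by rw [trace_sub, map_sub]
      _ ≤ RCLike.re (f k).trace - m := sub_le_sub_left (ciInf_le hbdd l) _
  choose P hP using fun i j => cauchySeq_tendsto_of_complete (hcauchy i j)
  have hfP : Tendsto f atTop (𝓝 (of P)) :=
    tendsto_pi_nhds.mpr fun i => tendsto_pi_nhds.mpr fun j => hP i j
  exact ⟨of P, isClosed_setOf_posSemidef.mem_of_tendsto hfP (.of_forall hpos), hfP⟩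

lemma exists_pos_le_of_mem_spectrum [Fintype ι] [DecidableEq ι] (A : Matrix ι ι 𝕜) :
    ∃ e : ℝ, 0 < e ∧ ∀ x ∈ spectrum ℝ A, 0 < x → e ≤ x := by
  obtain ⟨e, he, h⟩ := (Set.finite_singleton (0 : ℝ)).exists_between'
    ((Matrix.finite_real_spectrum (A := A)).inter_of_left (Set.Ioi 0))
    (fun _ hx _ hy => hx ▸ hy.2)
  exact ⟨e, he 0 rfl, fun x hx hx₀ => (h x ⟨hx, hx₀⟩).le⟩

lemma exists_pos_smul_one_le [Finite ι] [DecidableEq ι] (hJ : J.PosDef) :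
    ∃ e : ℝ, 0 < e ∧ e • (1 : Matrix ι ι 𝕜) ≤ J := by
  cases nonempty_fintype ι
  obtain ⟨e, he, h⟩ := exists_pos_le_of_mem_spectrum J
  refine ⟨e, he, ?_⟩
  rw [← Algebra.algebraMap_eq_smul_one]
  exact (algebraMap_le_iff_le_spectrum hJ.isHermitian.isSelfAdjoint).mpr fun x hx =>
    h x hx (hJ.isStrictlyPositive.spectrum_pos hx)

lemma exists_le_smul_one [Finite ι] [DecidableEq ι] (hA : A.IsHermitian) :
    ∃ t : ℝ, 0 < t ∧ A ≤ t • (1 : Matrix ι ι 𝕜) := by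
  cases nonempty_fintype ι
  obtain ⟨t, ht⟩ := (Matrix.finite_real_spectrum (A := A)).bddAbove
  refine ⟨max t 1, by positivity, ?_⟩
  rw [← Algebra.algebraMap_eq_smul_one]
  exact (le_algebraMap_iff_spectrum_le hA.isSelfAdjoint).mpr fun x hx =>
    (ht hx).trans (le_max_left _ _)

lemma exists_pos_smul_le_sq [Fintype ι] (hS : S.PosSemidef) :
    ∃ e : ℝ, 0 < e ∧ e • S ≤ S * S := by
  classical
  obtain ⟨e, he, h⟩ := exists_pos_le_of_mem_spectrum S
  refine ⟨e, he, ?_⟩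
  have hle : cfc (fun x : ℝ => e * x) S ≤ cfc (fun x : ℝ => x * x) S := by
    refine cfc_mono fun x hx => ?_
    rcases (spectrum_nonneg_of_nonneg hS.nonneg hx).eq_or_lt with rfl | hx₀
    · simp
    · exact mul_le_mul_of_nonneg_right (h x hx hx₀) hx₀.le
  rwa [cfc_const_mul_id e S hS.isHermitian.isSelfAdjoint,
    cfc_mul (fun x : ℝ => x) (fun x => x) S, cfc_id' ℝ S] at hle

lemma exists_pos_smul_le [Finite ι] (hX : X.PosDef) (hP : P.IsHermitian) :
    ∃ e : ℝ, 0 < e ∧ e • P ≤ X := by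
  classical
  cases nonempty_fintype ι
  obtain ⟨e, he, hX⟩ := exists_pos_smul_one_le hX
  obtain ⟨t, ht, hP⟩ := exists_le_smul_one hP
  refine ⟨e / t, by positivity, ?_⟩
  calc (e / t) • P ≤ (e / t) • t • (1 : Matrix ι ι 𝕜) :=
        smul_le_smul_of_nonneg_left hP (by positivity)
    _ = e • 1 := by rw [smul_smul, div_mul_cancel₀ e ht.ne']
    _ ≤ X := hX

lemma exists_pos_smul_le_mul_mul [Fintype ι] (hS : S.PosSemidef) (hJ : J.PosDef) :
    ∃ e : ℝ, 0 < e ∧ e • S ≤ S * J * S := by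
  classical
  obtain ⟨s, hs, hS'⟩ := exists_pos_smul_le_sq hS
  obtain ⟨j, hj, hJ'⟩ := exists_pos_smul_one_le hJ
  refine ⟨j * s, mul_pos hj hs, ?_⟩
  calc (j * s) • S = j • s • S := mul_smul j s S
    _ ≤ j • (S * S) := smul_le_smul_of_nonneg_left hS' hj.le
    _ = S * (j • 1) * S := by simp
    _ ≤ S * J * S := by
      simpa [star_eq_conjTranspose, hS.isHermitian.eq] using star_left_conjugate_le_conjugate hJ' S

end LoewnerOrder

section RiccatiMap

variable {𝕜 ι : Type*} [RCLike 𝕜] [Fintype ι] [DecidableEq ι]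

/-- The filter update over a stretch of time in closed form: a measurement with information `J`,
the dynamics `F`, then process noise with covariance `Q`. -/
noncomputable def riccatiMap (Q J F X : Matrix ι ι 𝕜) : Matrix ι ι 𝕜 :=
  Q + F * posteriorCov X J * Fᴴ

variable {Q Q₁ Q₂ J J₁ J₂ F F₁ F₂ P X Y : Matrix ι ι 𝕜}

lemma posSemidef_riccatiMap (hQ : Q.PosSemidef) (hJ : J.PosSemidef) (hX : X.PosSemidef) :
    (riccatiMap Q J F X).PosSemidef :=
  hQ.add ((posSemidef_posteriorCov hX hJ).mul_mul_conjTranspose_same F)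

lemma riccatiMap_mono (hJ : J.PosSemidef) (hX : X.PosSemidef) (hXY : X ≤ Y) :
    riccatiMap Q J F X ≤ riccatiMap Q J F Y :=
  add_le_add_right
    (star_right_conjugate_le_conjugate (posteriorCov_mono_left hX hXY hJ) F) Q

lemma riccatiMap_le (hJ : J.PosDef) (hX : X.PosSemidef) :
    riccatiMap Q J F X ≤ Q + F * J⁻¹ * Fᴴ :=
  add_le_add_right (star_right_conjugate_le_conjugate (posteriorCov_le_inv hX hJ) F) Q

lemma posSemidef_iterate_riccatiMap (hQ : Q.PosSemidef) (hJ : J.PosSemidef)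
    (hX : X.PosSemidef) (k : ℕ) : ((riccatiMap Q J F)^[k] X).PosSemidef :=
  Function.Iterate.rec PosSemidef hX (fun _ => posSemidef_riccatiMap hQ hJ) k

lemma iterate_riccatiMap_mono (hQ : Q.PosSemidef) (hJ : J.PosSemidef) (hX : X.PosSemidef)
    (hXY : X ≤ Y) (k : ℕ) : (riccatiMap Q J F)^[k] X ≤ (riccatiMap Q J F)^[k] Y := by
  induction k with
  | zero => exact hXY
  | succ k ih =>
    rw [Function.iterate_succ_apply', Function.iterate_succ_apply']
    exact riccatiMap_mono hJ (posSemidef_iterate_riccatiMap hQ hJ hX k) ih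

lemma continuousAt_riccatiMap (hJ : J.PosSemidef) (hX : X.PosSemidef) :
    ContinuousAt (riccatiMap Q J F) X := by
  have hinv : ContinuousAt Inv.inv (1 + X * J) :=
    continuousAt_matrix_inv _ <| by
      rw [Ring.inverse_eq_inv']
      exact continuousAt_inv₀ ((isUnit_iff_isUnit_det _).mp (isUnit_one_add_mul hX hJ)).ne_zero
  have hadd : ContinuousAt (fun X => 1 + X * J) X := by fun_prop
  have hpost : ContinuousAt (fun X => posteriorCov X J) X :=
    (ContinuousAt.comp (f := fun X => 1 + X * J) hinv hadd).mul continuousAt_id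
  unfold riccatiMap
  fun_prop

lemma riccatiMap_riccatiMap (hQ₁ : Q₁.PosSemidef) (hJ₁ : J₁.PosSemidef) (hJ₂ : J₂.PosSemidef)
    (hX : X.PosSemidef) :
    riccatiMap Q₂ J₂ F₂ (riccatiMap Q₁ J₁ F₁ X) =
      riccatiMap (riccatiMap Q₂ J₂ F₂ Q₁) (riccatiMap J₁ Q₁ F₁ᴴ J₂)
        (F₂ * (1 - Q₁ * posteriorCov J₂ Q₁) * F₁) X := by
  have hK := posSemidef_posteriorCov hJ₂ hQ₁
  have hS := posSemidef_posteriorCov hX hJ₁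
  simp only [riccatiMap]
  rw [posteriorCov_add hQ₁ (hS.mul_mul_conjTranspose_same F₁) hJ₂,
    posteriorCov_mul_mul_conjTranspose hS hK, posteriorCov_posteriorCov hX hJ₁
    (hK.conjTranspose_mul_mul_same F₁)]
  simp only [conjTranspose_mul, conjTranspose_conjTranspose, Matrix.mul_add, Matrix.add_mul,
    Matrix.mul_assoc, add_assoc]

lemma exists_riccatiMap_fixedPoint (hQ : Q.PosSemidef) (hJ : J.PosDef) :
    ∃ P, P.PosSemidef ∧ riccatiMap Q J F P = P ∧
      Tendsto (fun k => (riccatiMap Q J F)^[k] (Q + F * J⁻¹ * Fᴴ)) atTop (𝓝 P) := by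
  set V := Q + F * J⁻¹ * Fᴴ
  have hV : V.PosSemidef := hQ.add (hJ.inv.posSemidef.mul_mul_conjTranspose_same F)
  have hanti : Antitone fun k => (riccatiMap Q J F)^[k] V :=
    antitone_nat_of_succ_le fun k =>
      iterate_riccatiMap_mono hQ hJ.posSemidef (posSemidef_riccatiMap hQ hJ.posSemidef hV)
        (riccatiMap_le hJ hV) k
  obtain ⟨P, hP, hlim⟩ :=
    exists_tendsto_of_antitone hanti (posSemidef_iterate_riccatiMap hQ hJ.posSemidef hV)
  refine ⟨P, hP, ?_, hlim⟩
  have hfP := (continuousAt_riccatiMap (Q := Q) (F := F) hJ.posSemidef hP).tendsto.comp hlim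
  refine tendsto_nhds_unique hfP ?_
  simpa only [Function.comp_def, ← Function.iterate_succ_apply'] using
    hlim.comp (tendsto_add_atTop_nat 1)

/-- The Riccati map is more than homogeneous below its fixed point, hence the lower iterates climb
towards `P` along the ray through it. -/
lemma exists_smul_le_riccatiMap_smul (hQ : Q.PosSemidef) (hJ : J.PosDef) (hP : P.PosSemidef)
    (hfix : riccatiMap Q J F P = P) :
    ∃ κ : ℝ, 0 < κ ∧ κ ≤ 1 ∧ ∀ e : ℝ, 0 ≤ e → e ≤ 1 →
      (1 - (1 - κ * e) * (1 - e)) • P ≤ riccatiMap Q J F (e • P) := by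
  set S := posteriorCov P J with hS_def
  have hS : S.PosSemidef := posSemidef_posteriorCov hP hJ.posSemidef
  obtain ⟨κ₀, hκ₀, hgain₀⟩ := exists_pos_smul_le_mul_mul hS hJ
  set κ := min κ₀ 1
  have hκ₁ : κ ≤ 1 := min_le_right _ _
  have hκ : 0 < κ := lt_min hκ₀ one_pos
  have hgain : κ • S ≤ S * J * S :=
    (smul_le_smul_of_nonneg_right (min_le_left _ _) hS.nonneg).trans hgain₀
  refine ⟨κ, hκ, hκ₁, fun e he₀ he₁ => ?_⟩
  set a := 1 - (1 - κ * e) * (1 - e) with ha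
  have ha₁ : a ≤ 1 := sub_le_self 1 <|
    mul_nonneg (sub_nonneg.mpr (mul_le_one₀ hκ₁ he₀ he₁)) (sub_nonneg.mpr he₁)
  have hpost : a • S ≤ posteriorCov (e • P) J :=
    calc a • S = e • (S + (1 - e) • κ • S) := by rw [ha]; module
      _ ≤ e • (S + (1 - e) • (S * J * S)) := by
          refine smul_le_smul_of_nonneg_left (add_le_add_right ?_ S) he₀
          exact smul_le_smul_of_nonneg_left hgain (sub_nonneg.mpr he₁)
      _ ≤ posteriorCov (e • P) J := smul_posteriorCov_add_le he₀ he₁ hP hJ.posSemidef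
  calc a • P = a • Q + F * (a • S) * Fᴴ := by
        conv_lhs => rw [← hfix, riccatiMap]
        simp [hS_def]
    _ ≤ Q + F * posteriorCov (e • P) J * Fᴴ := by
        refine add_le_add ?_ (star_right_conjugate_le_conjugate hpost F)
        simpa using smul_le_smul_of_nonneg_right ha₁ hQ.nonneg

lemma exists_smul_le_iterate_riccatiMap (hQ : Q.PosSemidef) (hJ : J.PosDef) (hP : P.PosSemidef)
    (hfix : riccatiMap Q J F P = P) (hX : X.PosDef) :
    ∃ e : ℕ → ℝ, Tendsto e atTop (𝓝 1) ∧ ∀ k, e k • P ≤ (riccatiMap Q J F)^[k] X := by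
  obtain ⟨κ, hκ, hκ₁, hgain⟩ := exists_smul_le_riccatiMap_smul hQ hJ hP hfix
  obtain ⟨e₀, he₀, heX⟩ := exists_pos_smul_le hX hP.isHermitian
  set e := min e₀ 1
  have he : 0 < e := lt_min he₀ one_pos
  have he₁ : 0 ≤ 1 - e := sub_nonneg.mpr (min_le_right _ _)
  set ρ := 1 - κ * e
  have hρ₀ : 0 ≤ ρ := sub_nonneg.mpr (mul_le_one₀ hκ₁ he.le (min_le_right _ _))
  have hρ₁ : ρ < 1 := sub_lt_self 1 (mul_pos hκ he)
  refine ⟨fun k => 1 - ρ ^ k * (1 - e), ?_, fun k => ?_⟩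
  · simpa using ((tendsto_pow_atTop_nhds_zero_of_lt_one hρ₀ hρ₁).mul_const (1 - e)).const_sub 1
  induction k with
  | zero =>
    simp only [pow_zero, one_mul, sub_sub_cancel]
    exact (smul_le_smul_of_nonneg_right (min_le_left _ _) hP.nonneg).trans heX
  | succ k ih =>
    set d := 1 - ρ ^ k * (1 - e)
    have hd₁ : d ≤ 1 := sub_le_self 1 (mul_nonneg (pow_nonneg hρ₀ k) he₁)
    have hed : e ≤ d := by
      linarith [mul_le_of_le_one_left he₁ (pow_le_one₀ (n := k) hρ₀ hρ₁.le)]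
    have hd₀ : 0 ≤ d := he.le.trans hed
    calc (1 - ρ ^ (k + 1) * (1 - e)) • P = (1 - ρ * (1 - d)) • P := by
          rw [pow_succ', sub_sub_cancel, mul_assoc]
      _ ≤ (1 - (1 - κ * d) * (1 - d)) • P := by
          refine smul_le_smul_of_nonneg_right (sub_le_sub_left ?_ 1) hP.nonneg
          exact mul_le_mul_of_nonneg_right
            (sub_le_sub_left (mul_le_mul_of_nonneg_left hed hκ.le) 1) (sub_nonneg.mpr hd₁)
      _ ≤ riccatiMap Q J F (d • P) := hgain d hd₀ hd₁
      _ ≤ (riccatiMap Q J F)^[k + 1] X := by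
          rw [Function.iterate_succ_apply']
          exact riccatiMap_mono hJ.posSemidef (hP.smul hd₀) ih

theorem exists_tendsto_iterate_riccatiMap (hQ : Q.PosSemidef) (hJ : J.PosDef)
    (F : Matrix ι ι 𝕜) :
    ∃ P, ∀ X, X.PosDef → Tendsto (fun k => (riccatiMap Q J F)^[k] X) atTop (𝓝 P) := by
  obtain ⟨P, hP, hfix, hupper⟩ := exists_riccatiMap_fixedPoint (F := F) hQ hJ
  refine ⟨P, fun X hX => (tendsto_add_atTop_iff_nat 1).mp ?_⟩
  obtain ⟨e, he, hlower⟩ := exists_smul_le_iterate_riccatiMap hQ hJ hP hfix hX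
  have hlim : Tendsto (fun k => e (k + 1) • P) atTop (𝓝 P) := by
    simpa using (he.comp (tendsto_add_atTop_nat 1)).smul_const P
  exact tendsto_of_le_of_le (fun k => hlower (k + 1))
    (iterate_riccatiMap_mono hQ hJ.posSemidef
      (posSemidef_riccatiMap hQ hJ.posSemidef hX.posSemidef) (riccatiMap_le hJ hX.posSemidef))
    hlim hupper

end RiccatiMap

section Kernel

variable {𝕜 ι : Type*} [RCLike 𝕜] [Fintype ι]

lemma mulVec_eq_zero_of_add_mulVec_eq_zero {P Q : Matrix ι ι 𝕜} (hP : P.PosSemidef)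
    (hQ : Q.PosSemidef) {v : ι → 𝕜} (h : (P + Q) *ᵥ v = 0) : P *ᵥ v = 0 ∧ Q *ᵥ v = 0 := by
  have hsum : star v ⬝ᵥ P *ᵥ v + star v ⬝ᵥ Q *ᵥ v = 0 := by
    rw [← dotProduct_add, ← add_mulVec, h, dotProduct_zero]
  obtain ⟨hPv, hQv⟩ := (add_eq_zero_iff_of_nonneg (hP.dotProduct_mulVec_nonneg v)
    (hQ.dotProduct_mulVec_nonneg v)).mp hsum
  exact ⟨(hP.dotProduct_mulVec_zero_iff v).mp hPv, (hQ.dotProduct_mulVec_zero_iff v).mp hQv⟩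

lemma mulVec_mulVec_eq_zero_of_conjTranspose_mul_mul {κ : Type*} [Fintype κ]
    {P : Matrix κ κ 𝕜} {F : Matrix κ ι 𝕜} (hP : P.PosSemidef) {v : ι → 𝕜}
    (h : (Fᴴ * P * F) *ᵥ v = 0) : P *ᵥ (F *ᵥ v) = 0 := by
  refine (hP.dotProduct_mulVec_zero_iff _).mp ?_
  rw [star_mulVec, ← dotProduct_mulVec, mulVec_mulVec, mulVec_mulVec, h, dotProduct_zero]

end Kernel

lemma tendsto_of_tendsto_mul_add {α : Type*} {l : Filter α} {u : ℕ → α} {m : ℕ} (hm : m ≠ 0)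
    (h : ∀ j < m, Tendsto (fun q => u (m * q + j)) atTop l) : Tendsto u atTop l := by
  intro s hs
  have hresidue : ∀ᶠ q in atTop, ∀ j ∈ Finset.range m, u (m * q + j) ∈ s :=
    (eventually_all_finset _).2 fun j hj => h j (Finset.mem_range.1 hj) hs
  rw [mem_map]
  filter_upwards [(Nat.tendsto_div_const_atTop hm).eventually hresidue] with k hk
  simpa [Nat.div_add_mod] using
    hk (k % m) (Finset.mem_range.2 (Nat.mod_lt _ (Nat.pos_of_ne_zero hm)))

section FilterUpdate

variable {𝕜 ι : Type*} [RCLike 𝕜] [Fintype ι] [DecidableEq ι]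

lemma mulVec_eq_zero_of_riccatiMap_mulVec_eq_zero {Q J F X : Matrix ι ι 𝕜} (hQ : Q.PosSemidef)
    (hJ : J.PosSemidef) (hX : X.PosSemidef) {v : ι → 𝕜} (h : riccatiMap Q J Fᴴ X *ᵥ v = 0) :
    Q *ᵥ v = 0 ∧ posteriorCov X J *ᵥ (F *ᵥ v) = 0 := by
  have hS := posSemidef_posteriorCov hX hJ
  rw [riccatiMap, conjTranspose_conjTranspose] at h
  exact (mulVec_eq_zero_of_add_mulVec_eq_zero hQ (hS.conjTranspose_mul_mul_same F) h).imp_right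
    (mulVec_mulVec_eq_zero_of_conjTranspose_mul_mul hS)

/-- The covariance update `f` of a filter over a stretch of time with open-loop transition matrix
`T`: a Riccati map on the positive definite matrices, where a state that the measurements do not
see lies in `K` and evolves by `T`. -/
structure IsFilterUpdate (f : Matrix ι ι 𝕜 → Matrix ι ι 𝕜) (T : Matrix ι ι 𝕜)
    (K : Set (ι → 𝕜)) : Prop where
  posDef : ∀ ⦃X⦄, X.PosDef → (f X).PosDef
  exists_riccatiMap : ∃ Q J F : Matrix ι ι 𝕜, Q.PosSemidef ∧ J.PosSemidef ∧
    (∀ v, J *ᵥ v = 0 → v ∈ K ∧ F *ᵥ v = T *ᵥ v) ∧ ∀ X, X.PosDef → f X = riccatiMap Q J F X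

variable {f f₁ f₂ : Matrix ι ι 𝕜 → Matrix ι ι 𝕜} {T T₁ T₂ : Matrix ι ι 𝕜} {K K₁ K₂ : Set (ι → 𝕜)}

namespace IsFilterUpdate

lemma id : IsFilterUpdate (fun X : Matrix ι ι 𝕜 => X) 1 Set.univ where
  posDef _ hX := hX
  exists_riccatiMap := ⟨0, 0, 1, .zero, .zero, fun _ _ => ⟨trivial, rfl⟩, fun X _ => by
    simp [riccatiMap]⟩

lemma predict (hT : IsUnit T) {Q : Matrix ι ι 𝕜} (hQ : Q.PosSemidef) :
    IsFilterUpdate (fun X => T * X * Tᴴ + Q) T Set.univ where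
  posDef _ hX := (hX.mul_mul_conjTranspose_same (vecMul_injective_of_isUnit hT)).add_posSemidef hQ
  exists_riccatiMap := ⟨Q, 0, T, hQ, .zero, fun _ _ => ⟨trivial, rfl⟩, fun X _ => by
    rw [riccatiMap, posteriorCov_zero_right, add_comm]⟩

lemma measure {C : Matrix ι ι 𝕜} (hC : C.PosSemidef) :
    IsFilterUpdate (fun X => (X⁻¹ + C)⁻¹) 1 {v | C *ᵥ v = 0} where
  posDef _ hX := (hX.inv.add_posSemidef hC).inv
  exists_riccatiMap := ⟨0, C, 1, .zero, hC, fun _ hv => ⟨hv, rfl⟩, fun X hX => by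
    simp [riccatiMap, posteriorCov_eq_inv hX.isUnit]⟩

lemma comp (h₂ : IsFilterUpdate f₂ T₂ K₂) (h₁ : IsFilterUpdate f₁ T₁ K₁) :
    IsFilterUpdate (f₂ ∘ f₁) (T₂ * T₁) (K₁ ∩ (T₁ *ᵥ ·) ⁻¹' K₂) where
  posDef _ hX := h₂.posDef (h₁.posDef hX)
  exists_riccatiMap := by
    obtain ⟨Q₁, J₁, F₁, hQ₁, hJ₁, hker₁, hf₁⟩ := h₁.exists_riccatiMap
    obtain ⟨Q₂, J₂, F₂, hQ₂, hJ₂, hker₂, hf₂⟩ := h₂.exists_riccatiMap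
    refine ⟨riccatiMap Q₂ J₂ F₂ Q₁, riccatiMap J₁ Q₁ F₁ᴴ J₂,
      F₂ * (1 - Q₁ * posteriorCov J₂ Q₁) * F₁, posSemidef_riccatiMap hQ₂ hJ₂ hQ₁,
      posSemidef_riccatiMap hJ₁ hQ₁ hJ₂, fun v hv => ?_, fun X hX => ?_⟩
    · obtain ⟨hv₁, hv₂⟩ := mulVec_eq_zero_of_riccatiMap_mulVec_eq_zero hJ₁ hQ₁ hJ₂ hv
      have hJv : J₂ *ᵥ (F₁ *ᵥ v) = 0 := by
        rw [← one_add_mul_mul_posteriorCov hJ₂ hQ₁, ← mulVec_mulVec, hv₂, mulVec_zero]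
      obtain ⟨hvK₁, hFv₁⟩ := hker₁ v hv₁
      obtain ⟨hvK₂, hFv₂⟩ := hker₂ _ hJv
      refine ⟨⟨hvK₁, by rwa [Set.mem_preimage, ← hFv₁]⟩, ?_⟩
      rw [← mulVec_mulVec, ← mulVec_mulVec, sub_mulVec, ← mulVec_mulVec, hv₂, mulVec_zero,
        sub_zero, one_mulVec, hFv₂, hFv₁, mulVec_mulVec]
    · rw [Function.comp_apply, hf₂ _ (h₁.posDef hX), hf₁ X hX,
        riccatiMap_riccatiMap hQ₁ hJ₁ hJ₂ hX.posSemidef]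

lemma mono (h : IsFilterUpdate f T K₁) (hK : K₁ ⊆ K₂) : IsFilterUpdate f T K₂ where
  posDef := h.posDef
  exists_riccatiMap := by
    obtain ⟨Q, J, F, hQ, hJ, hker, hf⟩ := h.exists_riccatiMap
    exact ⟨Q, J, F, hQ, hJ, fun v hv => (hker v hv).imp_left (@hK v), hf⟩

lemma foldl {α : Type*} {f : α → Matrix ι ι 𝕜 → Matrix ι ι 𝕜} {K : α → Set (ι → 𝕜)}
    (h : ∀ a, IsFilterUpdate (f a) T (K a)) (l : List α) :
    IsFilterUpdate (fun X => l.foldl (fun Y a => f a Y) X) (T ^ l.length)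
      {v | ∀ k (hk : k < l.length), T ^ k *ᵥ v ∈ K l[k]} := by
  induction l with
  | nil => simpa using id.mono (Set.subset_univ _)
  | cons a l ih =>
    refine (pow_succ T l.length).symm ▸ (ih.comp (h a)).mono ?_
    rintro v ⟨hv₀, hv⟩ (_ | k) hk
    · simpa using hv₀
    · simpa [pow_succ, ← mulVec_mulVec] using hv k (Nat.lt_of_succ_lt_succ hk)

lemma iterate (h : IsFilterUpdate f T K) (k : ℕ) :
    IsFilterUpdate f^[k] (T ^ k) {v | ∀ i < k, T ^ i *ᵥ v ∈ K} := by
  have := foldl (fun _ : Unit => h) (List.replicate k ())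
  simpa [List.foldl_const] using this

theorem exists_tendsto_iterate (h : IsFilterUpdate f T K) (hK : K ⊆ {0}) :
    ∃ P, ∀ X, X.PosDef → Tendsto (fun k => f^[k] X) atTop (𝓝 P) := by
  obtain ⟨Q, J, F, hQ, hJ, hker, hf⟩ := h.exists_riccatiMap
  have hJpos : J.PosDef := by
    refine hJ.posDef_iff_isUnit.mpr (mulVec_injective_iff_isUnit.mp ?_)
    exact (injective_iff_map_eq_zero J.mulVecLin).mpr fun v hv => hK (hker v hv).1
  obtain ⟨P, hP⟩ := exists_tendsto_iterate_riccatiMap hQ hJpos F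
  refine ⟨P, fun X hX => (hP X hX).congr fun k => ?_⟩
  have hX' (k : ℕ) : (f^[k] X).PosDef := Function.Iterate.rec PosDef hX h.posDef k
  induction k with
  | zero => rfl
  | succ k ih =>
    rw [Function.iterate_succ_apply', Function.iterate_succ_apply', ih, hf _ (hX' k)]

theorem exists_tendsto_iterate_of_iterate (h : IsFilterUpdate f T K) {m : ℕ}
    (hm : m ≠ 0) (hK : ∀ v, (∀ i < m, T ^ i *ᵥ v ∈ K) → v = 0) :
    ∃ P, ∀ X, X.PosDef → Tendsto (fun k => f^[k] X) atTop (𝓝 P) := by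
  obtain ⟨P, hP⟩ := (h.iterate m).exists_tendsto_iterate hK
  refine ⟨P, fun X hX => tendsto_of_tendsto_mul_add hm fun j _ => ?_⟩
  have hXj : (f^[j] X).PosDef := Function.Iterate.rec PosDef hX h.posDef j
  simpa only [← Function.iterate_mul, ← Function.iterate_add_apply] using hP _ hXj

end IsFilterUpdate

end FilterUpdate

section KalmanPeriod

lemma posSemidef_intervalIntegral {ι : Type*} [Finite ι] {M : ℝ → Matrix ι ι ℝ}
    (hM : Continuous M) (hpos : ∀ s, (M s).PosSemidef) {a b : ℝ} (hab : a ≤ b) :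
    (Matrix.of fun i j => ∫ s in a..b, M s i j).PosSemidef := by
  cases nonempty_fintype ι
  have hcont (i j : ι) : Continuous fun s => M s i j := hM.matrix_elem i j
  refine .of_dotProduct_mulVec_nonneg ?_ fun v => ?_
  · ext i j
    simp only [conjTranspose_apply, of_apply, star_trivial]
    exact intervalIntegral.integral_congr fun s _ => by simpa using (hpos s).1.apply i j
  have hquad : star v ⬝ᵥ (Matrix.of fun i j => ∫ s in a..b, M s i j) *ᵥ v =
      ∫ s in a..b, star v ⬝ᵥ M s *ᵥ v := by
    simp only [dotProduct, mulVec, Finset.mul_sum, of_apply]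
    rw [intervalIntegral.integral_finsetSum fun i _ =>
      Continuous.intervalIntegrable (by fun_prop) _ _]
    refine Finset.sum_congr rfl fun i _ => ?_
    rw [intervalIntegral.integral_finsetSum fun j _ =>
      Continuous.intervalIntegrable (by fun_prop) _ _]
    simp only [intervalIntegral.integral_const_mul, intervalIntegral.integral_mul_const]
  rw [hquad]
  exact intervalIntegral.integral_nonneg hab fun s _ => (hpos s).dotProduct_mulVec_nonneg v

variable {n m p N r : ℕ} {A : Matrix (Fin n) (Fin n) ℝ} {G : Matrix (Fin n) (Fin m) ℝ}
  {S : Matrix (Fin n) (Fin n) ℝ} {t : ℝ}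

lemma exp_smul_transpose (A : Matrix (Fin n) (Fin n) ℝ) (t : ℝ) :
    NormedSpace.exp (t • Aᵀ) = (NormedSpace.exp (t • A))ᴴ := by
  rw [conjTranspose_eq_transpose_of_trivial, ← Matrix.exp_transpose, transpose_smul]

lemma continuous_exp_smul (A : Matrix (Fin n) (Fin n) ℝ) :
    Continuous fun s : ℝ => NormedSpace.exp (s • A) :=
  have hexp : Continuous (NormedSpace.exp : Matrix (Fin n) (Fin n) ℝ → _) :=
    open scoped Matrix.Norms.Operator in NormedSpace.exp_continuous
  hexp.comp (by fun_prop)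

lemma posSemidef_noiseCov (ht : 0 ≤ t) : (noiseCov A G t).PosSemidef := by
  refine posSemidef_intervalIntegral (((continuous_exp_smul A).mul continuous_const).mul
    (continuous_exp_smul Aᵀ)) (fun s => ?_) ht
  change (NormedSpace.exp (s • A) * (G * Gᵀ) * NormedSpace.exp (s • Aᵀ)).PosSemidef
  rw [exp_smul_transpose, ← conjTranspose_eq_transpose_of_trivial G]
  exact (posSemidef_self_mul_conjTranspose G).mul_mul_conjTranspose_same _

lemma noiseCov_zero : noiseCov A G 0 = 0 := by
  ext
  simp [noiseCov]

lemma predictCov_eq : predictCov A G t S =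
    NormedSpace.exp (t • A) * S * (NormedSpace.exp (t • A))ᴴ + noiseCov A G t := by
  rw [predictCov, exp_smul_transpose]

lemma posSemidef_predictCov (ht : 0 ≤ t) (hS : S.PosSemidef) :
    (predictCov A G t S).PosSemidef := by
  rw [predictCov_eq]
  exact (hS.mul_mul_conjTranspose_same _).add (posSemidef_noiseCov ht)

lemma posSemidef_mul_transpose (c : Matrix (Fin n) (Fin p) ℝ) : (c * cᵀ).PosSemidef := by
  simpa using posSemidef_self_mul_conjTranspose c

lemma posDef_slotUpdate (ht : 0 ≤ t) (c : Matrix (Fin n) (Fin p) ℝ) (hS : S.PosSemidef)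
    (hunit : IsUnit (predictCov A G t S)) : (slotUpdate A G t c S).PosDef :=
  (((posSemidef_predictCov ht hS).posDef_iff_isUnit.mpr hunit).inv.add_posSemidef
    (posSemidef_mul_transpose c)).inv

lemma isFilterUpdate_slotUpdate (ht : 0 ≤ t) (c : Matrix (Fin n) (Fin p) ℝ) :
    IsFilterUpdate (slotUpdate A G t c) (NormedSpace.exp (t • A))
      {v | cᵀ *ᵥ (NormedSpace.exp (t • A) *ᵥ v) = 0} := by
  have hslot := (IsFilterUpdate.measure (posSemidef_mul_transpose c)).comp
    (.predict (Matrix.isUnit_exp (t • A)) (posSemidef_noiseCov (A := A) (G := G) ht))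
  rw [one_mul] at hslot
  simp only [Function.comp_def, ← predictCov_eq] at hslot
  refine hslot.mono fun v hv => ?_
  exact (self_mul_conjTranspose_mulVec_eq_zero c _).mp hv.2

lemma isFilterUpdate_foldl_slotUpdate (ht : 0 ≤ t) (c : Fin N → Matrix (Fin n) (Fin p) ℝ)
    (l : List (Fin N)) :
    IsFilterUpdate (fun X => l.foldl (fun Y i => slotUpdate A G t (c i) Y) X)
      (NormedSpace.exp (t • A) ^ l.length) {v | ∀ k (hk : k < l.length),
        (c l[k])ᵀ *ᵥ (NormedSpace.exp (t • A) ^ (k + 1) *ᵥ v) = 0} :=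
  (IsFilterUpdate.foldl (fun i => isFilterUpdate_slotUpdate ht (c i)) l).mono fun v hv k hk => by
    rw [pow_succ', ← mulVec_mulVec]
    exact hv k hk

variable (c : Fin N → Matrix (Fin n) (Fin p) ℝ) {τ : ℝ} (R : Fin r → Fin N)

lemma isFilterUpdate_periodUpdate (hτ : 0 ≤ τ) :
    IsFilterUpdate (periodUpdate A G c τ R) (NormedSpace.exp ((τ / r) • A) ^ r)
      {v | ∀ l : Fin r,
        (c (R l))ᵀ *ᵥ (NormedSpace.exp ((τ / r) • A) ^ (l + 1 : ℕ) *ᵥ v) = 0} := by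
  have hfoldl := (isFilterUpdate_foldl_slotUpdate (A := A) (G := G)
    (div_nonneg hτ r.cast_nonneg) c (List.ofFn R)).mono
    (K₂ := {v | ∀ l : Fin r,
      (c (R l))ᵀ *ᵥ (NormedSpace.exp ((τ / r) • A) ^ (l + 1 : ℕ) *ᵥ v) = 0})
    fun v hv l => by simpa using hv l (by simp)
  rwa [List.length_ofFn] at hfoldl

lemma posDef_periodUpdate (hτ : 0 ≤ τ) (hS : S.PosSemidef)
    (hunit : IsUnit (predictCov A G (τ / r) S)) : (periodUpdate A G c τ R S).PosDef := by
  have ht : 0 ≤ τ / r := div_nonneg hτ r.cast_nonneg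
  rw [periodUpdate]
  cases hl : List.ofFn R with
  | nil =>
    obtain rfl : r = 0 := by simpa using hl
    exact hS.posDef_iff_isUnit.mpr (by simpa [predictCov, noiseCov_zero] using hunit)
  | cons i l =>
    exact (isFilterUpdate_foldl_slotUpdate ht c l).posDef (posDef_slotUpdate ht (c i) hS hunit)

end KalmanPeriod

section MatrixExponential

variable {𝕜 ι : Type*} [RCLike 𝕜] [Fintype ι] [DecidableEq ι] {A N : Matrix ι ι 𝕜} {z μ : 𝕜}
  {v : ι → 𝕜}

lemma exp_mulVec_of_mulVec_mulVec_eq_zero (h : N *ᵥ (N *ᵥ v) = 0) :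
    NormedSpace.exp N *ᵥ v = v + N *ᵥ v := by
  have hseries : HasSum (fun k : ℕ => (k.factorial⁻¹ : 𝕜) • N ^ k) (NormedSpace.exp N) :=
    open scoped Matrix.Norms.Operator in NormedSpace.exp_series_hasSum_exp' (𝕂 := 𝕜) N
  have hsum := hseries.map (mulVec.addMonoidHomLeft v)
    (show Continuous fun M : Matrix ι ι 𝕜 => M *ᵥ v by fun_prop)
  have hfinite := hasSum_sum_of_ne_finset_zero (L := .unconditional ℕ) (s := Finset.range 2)
    (f := mulVec.addMonoidHomLeft v ∘ fun k : ℕ => (k.factorial⁻¹ : 𝕜) • N ^ k) fun k hk => by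
      obtain ⟨k, rfl⟩ := Nat.exists_eq_add_of_le' (not_lt.mp (Finset.mem_range.not.mp hk))
      simp [mulVec.addMonoidHomLeft, smul_mulVec, pow_add, sq, ← mulVec_mulVec, h]
  simpa [Finset.sum_range_succ, mulVec.addMonoidHomLeft] using hsum.unique hfinite

lemma exp_eq_exp_smul_exp_sub (A : Matrix ι ι 𝕜) (z : 𝕜) :
    NormedSpace.exp A = NormedSpace.exp z • NormedSpace.exp (A - z • 1) := by
  have hcomm : Commute (algebraMap 𝕜 (Matrix ι ι 𝕜) z) (A - z • 1) := Algebra.commutes _ _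
  have hscalar : algebraMap 𝕜 (Matrix ι ι 𝕜) (NormedSpace.exp z) =
      NormedSpace.exp (algebraMap 𝕜 (Matrix ι ι 𝕜) z) :=
    open scoped Matrix.Norms.Operator in NormedSpace.algebraMap_exp_comm z
  rw [← smul_one_mul (NormedSpace.exp z), ← Algebra.algebraMap_eq_smul_one, hscalar,
    ← Matrix.exp_add_of_commute _ _ hcomm, Algebra.algebraMap_eq_smul_one, add_sub_cancel]

lemma exp_mulVec_of_mulVec_eq_smul (h : A *ᵥ v = z • v) :
    NormedSpace.exp A *ᵥ v = NormedSpace.exp z • v := by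
  have hsub : (A - z • 1) *ᵥ v = 0 := by
    rw [sub_mulVec, smul_mulVec, one_mulVec, h, sub_self]
  rw [exp_eq_exp_smul_exp_sub A z, smul_mulVec,
    exp_mulVec_of_mulVec_mulVec_eq_zero (by rw [hsub, mulVec_zero]), hsub, add_zero]

lemma mulVec_eq_zero_of_pow_mulVec_eq_zero_of_exp_mulVec {k : ℕ} (hk : N ^ k *ᵥ v = 0)
    (hexp : NormedSpace.exp N *ᵥ v = μ • v) : N *ᵥ v = 0 := by
  induction k generalizing v with
  | zero => rw [← one_mulVec v, ← pow_zero N, hk, mulVec_zero]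
  | succ k ih =>
    have hcomm : Commute N (NormedSpace.exp N) := (Commute.refl N).exp_right
    have hN₂ : N *ᵥ (N *ᵥ v) = 0 := by
      refine ih (by rwa [mulVec_mulVec, ← pow_succ]) ?_
      rw [mulVec_mulVec, ← hcomm.eq, ← mulVec_mulVec, hexp, mulVec_smul]
    have hNv : N *ᵥ v = (μ - 1) • v := by
      rw [sub_smul, one_smul, ← hexp, exp_mulVec_of_mulVec_mulVec_eq_zero hN₂,
        add_sub_cancel_left]
    have hμ : (μ - 1) • N *ᵥ v = 0 := by rw [← mulVec_smul, ← hNv, hN₂]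
    rcases smul_eq_zero.mp hμ with h | h
    · rw [hNv, h, zero_smul]
    · exact h

lemma mulVec_eq_smul_of_mem_maxGenEigenspace_of_exp_mulVec
    (hv : v ∈ Module.End.maxGenEigenspace (toLin' A) z) (hexp : NormedSpace.exp A *ᵥ v = μ • v) :
    A *ᵥ v = z • v := by
  obtain ⟨k, hk⟩ := Module.End.mem_maxGenEigenspace _ _ _ |>.mp hv
  have hnil : (A - z • 1) ^ k *ᵥ v = 0 := by
    rw [← toLin'_apply, toLin'_pow, map_sub, map_smul, toLin'_one]
    exact hk
  have hsub := mulVec_eq_zero_of_pow_mulVec_eq_zero_of_exp_mulVec (μ := NormedSpace.exp (-z) * μ)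
    hnil <| by
      rw [mul_smul, ← hexp, exp_eq_exp_smul_exp_sub A z, smul_mulVec, smul_smul,
        ← NormedSpace.exp_add, neg_add_cancel, NormedSpace.exp_zero, one_smul]
  rwa [sub_mulVec, smul_mulVec, one_mulVec, sub_eq_zero] at hsub

end MatrixExponential

section SampledObservability

lemma eq_zero_of_map_ofReal_mulVec_eq_zero {ι κ : Type*} [Fintype ι] {O : Matrix κ ι ℝ}
    (hO : ∀ v, O *ᵥ v = 0 → v = 0) {x : ι → ℂ}
    (hx : O.map (algebraMap ℝ ℂ) *ᵥ x = 0) : x = 0 := by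
  have hre : (fun a => (x a).re) = 0 := hO _ <| funext fun k => by
    simpa [mulVec, dotProduct] using congrArg Complex.re (congrFun hx k)
  have him : (fun a => (x a).im) = 0 := hO _ <| funext fun k => by
    simpa [mulVec, dotProduct] using congrArg Complex.im (congrFun hx k)
  exact funext fun a => Complex.ext (congrFun hre a) (congrFun him a)

variable {ι κ : Type*} [Fintype ι] [DecidableEq ι]

lemma pow_mulVec_of_mulVec_eq_smul {R : Type*} [CommSemiring R] {A : Matrix ι ι R} {z : R}
    {v : ι → R} (h : A *ᵥ v = z • v) (k : ℕ) : A ^ k *ᵥ v = z ^ k • v := by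
  induction k with
  | zero => simp
  | succ k ih => rw [pow_succ', ← mulVec_mulVec, ih, mulVec_smul, h, smul_smul, pow_succ]

lemma mem_spectrum_of_mulVec_eq_smul {𝕜 : Type*} [Field 𝕜] {A : Matrix ι ι 𝕜} {z : 𝕜}
    {v : ι → 𝕜} (hv : v ≠ 0) (h : A *ᵥ v = z • v) : z ∈ spectrum 𝕜 A := by
  rw [← Matrix.spectrum_toLin']
  exact (Module.End.hasEigenvalue_of_hasEigenvector
    ⟨Module.End.mem_eigenspace_iff.mpr h, hv⟩).mem_spectrum

lemma mulVec_pow_mulVec_eq_zero {R : Type*} [CommRing R] [Nontrivial R] {C : Matrix κ ι R}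
    {M : Matrix ι ι R} {v : ι → R}
    (h : ∀ k ≤ Fintype.card ι, C *ᵥ (M ^ k *ᵥ v) = 0) (k : ℕ) : C *ᵥ (M ^ k *ᵥ v) = 0 := by
  have hdeg : (Polynomial.X ^ k %ₘ M.charpoly).natDegree < Fintype.card ι + 1 := by
    have := Polynomial.natDegree_modByMonic_le (Polynomial.X ^ k) M.charpoly_monic
    rw [charpoly_natDegree_eq_dim] at this
    lia
  rw [pow_eq_aeval_mod_charpoly, Polynomial.aeval_eq_sum_range' hdeg, sum_mulVec, mulVec_sum]
  refine Finset.sum_eq_zero fun j hj => ?_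
  rw [smul_mulVec, mulVec_smul, h j (Finset.mem_range_succ_iff.1 hj), smul_zero]

theorem exists_mulVec_eq_smul_of_exp_mulVec_eq_smul {A : Matrix ι ι ℂ}
    (hA : Set.InjOn Complex.exp (spectrum ℂ A)) {μ : ℂ} {v : ι → ℂ}
    (h : NormedSpace.exp A *ᵥ v = μ • v) : ∃ z : ℂ, A *ᵥ v = z • v := by
  set V := Module.End.eigenspace (toLin' (NormedSpace.exp A)) μ
  have hinv : ∀ x ∈ V, toLin' A x ∈ V := fun x hx =>
    Module.End.mapsTo_genEigenspace_of_comm (f := toLin' (NormedSpace.exp A)) (g := toLin' A)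
      ((Commute.refl A).exp_left.map toLinAlgEquiv') μ 1 hx
  have hpart (z : ℂ) (x : ι → ℂ) (hx : x ∈ V ⊓ Module.End.maxGenEigenspace (toLin' A) z)
      (hx₀ : x ≠ 0) :
      A *ᵥ x = z • x ∧ z ∈ spectrum ℂ A ∧ Complex.exp z = μ := by
    have hxV : NormedSpace.exp A *ᵥ x = μ • x := Module.End.mem_eigenspace_iff.mp hx.1
    have hAx := mulVec_eq_smul_of_mem_maxGenEigenspace_of_exp_mulVec hx.2 hxV
    refine ⟨hAx, mem_spectrum_of_mulVec_eq_smul hx₀ hAx, smul_left_injective ℂ hx₀ ?_⟩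
    simp only [Complex.exp_eq_exp_ℂ, ← exp_mulVec_of_mulVec_eq_smul hAx, hxV]
  obtain ⟨z, hz⟩ : ∃ z, ∀ w ∈ spectrum ℂ A, Complex.exp w = μ → w = z := by
    by_cases hμ : ∃ z ∈ spectrum ℂ A, Complex.exp z = μ
    · obtain ⟨z, hz, rfl⟩ := hμ
      exact ⟨z, fun w hw hwz => hA hw hz hwz⟩
    · exact ⟨0, fun w hw hwμ => absurd ⟨w, hw, hwμ⟩ hμ⟩
  have hle : V ≤ Module.End.eigenspace (toLin' A) z := by
    rw [Submodule.eq_iSup_inf_genEigenspace ⊤ hinv (Module.End.iSup_maxGenEigenspace_eq_top _)]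
    refine iSup_le fun w x hx => ?_
    rcases eq_or_ne x 0 with rfl | hx₀
    · exact zero_mem _
    obtain ⟨hAx, hw, hwμ⟩ := hpart w x hx hx₀
    exact Module.End.mem_eigenspace_iff.mpr (hz w hw hwμ ▸ hAx)
  exact ⟨z, Module.End.mem_eigenspace_iff.mp (hle (Module.End.mem_eigenspace_iff.mpr h))⟩

lemma exists_eigenvector_of_forall_mulVec_pow_eq_zero {α : Type*} {M : Matrix ι ι ℂ}
    {H : α → Matrix κ ι ℂ} {v : ι → ℂ} (hv : v ≠ 0) (h : ∀ a k, H a *ᵥ (M ^ k *ᵥ v) = 0) :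
    ∃ x ≠ 0, (∃ μ : ℂ, M *ᵥ x = μ • x) ∧ ∀ a, H a *ᵥ x = 0 := by
  let U : Submodule ℂ (ι → ℂ) := ⨅ (a) (k : ℕ), LinearMap.ker (H a * M ^ k).mulVecLin
  have hU (x : ι → ℂ) : x ∈ U ↔ ∀ a k, (H a * M ^ k) *ᵥ x = 0 := by simp [U]
  have hinv : ∀ x ∈ U, toLin' M x ∈ U := fun x hx => (hU _).mpr fun a k => by
    rw [toLin'_apply, mulVec_mulVec, Matrix.mul_assoc, ← pow_succ]
    exact (hU x).mp hx a (k + 1)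
  have hvU : v ∈ U := (hU v).mpr fun a k => by rw [← mulVec_mulVec, h]
  have : Nontrivial U := ⟨⟨v, hvU⟩, 0, fun h₀ => hv (congrArg Subtype.val h₀)⟩
  obtain ⟨μ, hμ⟩ := Module.End.exists_eigenvalue ((toLin' M).restrict hinv)
  obtain ⟨x, hx, hx₀⟩ := hμ.exists_hasEigenvector
  refine ⟨x, fun h₀ => hx₀ (Subtype.ext h₀), ⟨μ, ?_⟩, fun a => ?_⟩
  · simpa using congrArg Subtype.val (Module.End.mem_eigenspace_iff.mp hx)
  · simpa using (hU x).mp x.2 a 0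

lemma map_exp_smul (A : Matrix ι ι ℝ) (t : ℝ) :
    (NormedSpace.exp (t • A)).map (algebraMap ℝ ℂ) =
      NormedSpace.exp ((t : ℂ) • A.map (algebraMap ℝ ℂ)) := by
  have hcont : Continuous ((algebraMap ℝ ℂ).mapMatrix (m := ι)) :=
    continuous_id.matrix_map Complex.continuous_ofReal
  have hexp : (NormedSpace.exp (t • A)).map (algebraMap ℝ ℂ) =
      NormedSpace.exp ((algebraMap ℝ ℂ).mapMatrix (t • A)) :=
    open scoped Matrix.Norms.Operator in
      NormedSpace.map_exp (algebraMap ℝ ℂ).mapMatrix hcont (t • A)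
  refine hexp.trans (congrArg NormedSpace.exp ?_)
  ext i j
  simp

end SampledObservability

section Observable

variable {n N r p : ℕ} {κ : Type*} {A : Matrix (Fin n) (Fin n) ℝ}
  {C : Matrix (Fin n) κ ℝ}

lemma eq_zero_of_observabilityMatrix_mulVec_eq_zero (hobs : IsObservable A C) {v : Fin n → ℝ}
    (hv : observabilityMatrix A C *ᵥ v = 0) : v = 0 := by
  have hker : LinearMap.ker (observabilityMatrix A C).mulVecLin = ⊥ := by
    refine Submodule.finrank_eq_zero.mp ?_
    have hranknull := (observabilityMatrix A C).mulVecLin.finrank_range_add_finrank_ker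
    rw [Module.finrank_fin_fun] at hranknull
    have hrank : Module.finrank ℝ (observabilityMatrix A C).mulVecLin.range = n := hobs
    lia
  exact LinearMap.ker_eq_bot'.mp hker v hv

lemma eq_zero_of_isObservable_of_mulVec_eq_smul (hobs : IsObservable A C) {x : Fin n → ℂ} {z : ℂ}
    (hx : A.map (algebraMap ℝ ℂ) *ᵥ x = z • x) (hC : Cᵀ.map (algebraMap ℝ ℂ) *ᵥ x = 0) :
    x = 0 := by
  refine eq_zero_of_map_ofReal_mulVec_eq_zero
    (fun v => eq_zero_of_observabilityMatrix_mulVec_eq_zero hobs) (funext fun ⟨k, j⟩ => ?_)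
  have hrow : (Cᵀ * A ^ (k : ℕ)).map (algebraMap ℝ ℂ) *ᵥ x = 0 := by
    rw [Matrix.map_mul, Matrix.map_pow, ← mulVec_mulVec, pow_mulVec_of_mulVec_eq_smul hx,
      mulVec_smul, hC, smul_zero]
  exact congrFun hrow j

lemma concatSensors_transpose_map_mulVec_eq_zero {c : Fin N → Matrix (Fin n) (Fin p) ℝ}
    {x : Fin n → ℂ} (hc : ∀ i, (c i)ᵀ.map (algebraMap ℝ ℂ) *ᵥ x = 0) :
    (concatSensors c)ᵀ.map (algebraMap ℝ ℂ) *ᵥ x = 0 :=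
  funext fun ⟨i, j⟩ => congrFun (hc i) j

variable {c : Fin N → Matrix (Fin n) (Fin p) ℝ} {τ : ℝ} {v : Fin n → ℝ}

lemma exp_smul_map_pow_mulVec_of_mulVec_eq_smul {x : Fin n → ℂ} {z : ℂ}
    (h : A.map (algebraMap ℝ ℂ) *ᵥ x = z • x) (t : ℝ) (q : ℕ) :
    (NormedSpace.exp (t • A)).map (algebraMap ℝ ℂ) ^ q *ᵥ x = Complex.exp (q * (t * z)) • x := by
  have hexp : NormedSpace.exp ((t : ℂ) • A.map (algebraMap ℝ ℂ)) *ᵥ x =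
      Complex.exp (t * z) • x := by
    rw [Complex.exp_eq_exp_ℂ]
    exact exp_mulVec_of_mulVec_eq_smul (by rw [smul_mulVec, h, smul_smul])
  rw [map_exp_smul, pow_mulVec_of_mulVec_eq_smul hexp, Complex.exp_nat_mul]

lemma injOn_exp_of_mem_nonAliasingPeriods (hτ : τ ∈ nonAliasingPeriods A) :
    Set.InjOn Complex.exp (spectrum ℂ ((τ : ℂ) • A.map (algebraMap ℝ ℂ))) := by
  have hτ₀ : (τ : ℂ) ≠ 0 := Complex.ofReal_ne_zero.mpr hτ.1.ne'
  rw [← Units.val_mk0 hτ₀, ← Units.smul_def, spectrum.unit_smul_eq_smul]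
  rintro _ ⟨z, hz, rfl⟩ _ ⟨w, hw, rfl⟩ hzw
  by_contra hne
  refine hτ.2 z hz w hw (fun h => hne (congrArg _ h)) ?_
  simpa [Units.smul_def, mul_comm] using hzw

theorem eq_zero_of_forall_sampled (hobs : IsObservable A (concatSensors c))
    (hτ : τ ∈ nonAliasingPeriods A) (t : ℝ) (q : Fin N → ℕ)
    (h : ∀ i k, ((c i)ᵀ * NormedSpace.exp (t • A) ^ q i) *ᵥ
      (NormedSpace.exp (τ • A) ^ k *ᵥ v) = 0) : v = 0 := by
  by_contra hv
  obtain ⟨x, hx₀, ⟨μ, hμ⟩, hx⟩ := exists_eigenvector_of_forall_mulVec_pow_eq_zero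
    (M := (NormedSpace.exp (τ • A)).map (algebraMap ℝ ℂ))
    (H := fun i => ((c i)ᵀ * NormedSpace.exp (t • A) ^ q i).map (algebraMap ℝ ℂ))
    (v := algebraMap ℝ ℂ ∘ v) (fun h₀ => hv (funext fun a => by simpa using congrFun h₀ a))
    fun i k => by
      rw [← Matrix.map_pow, mulVec_mulVec, ← Matrix.map_mul]
      ext a
      rw [← RingHom.map_mulVec, ← mulVec_mulVec, h i k]
      simp
  rw [map_exp_smul] at hμ
  obtain ⟨z, hz⟩ :=
    exists_mulVec_eq_smul_of_exp_mulVec_eq_smul (injOn_exp_of_mem_nonAliasingPeriods hτ) hμ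
  have hAx : A.map (algebraMap ℝ ℂ) *ᵥ x = ((τ : ℂ)⁻¹ * z) • x := by
    rw [mul_smul, ← hz, smul_mulVec, inv_smul_smul₀ (Complex.ofReal_ne_zero.mpr hτ.1.ne')]
  refine hx₀ (eq_zero_of_isObservable_of_mulVec_eq_smul hobs hAx
    (concatSensors_transpose_map_mulVec_eq_zero fun i => ?_))
  have hEx := exp_smul_map_pow_mulVec_of_mulVec_eq_smul hAx t (q i)
  have hcx := hx i
  rw [Matrix.map_mul, Matrix.map_pow, ← mulVec_mulVec, hEx, mulVec_smul] at hcx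
  exact (smul_eq_zero.mp hcx).resolve_left (Complex.exp_ne_zero _)

lemma eq_zero_of_forall_period (hobs : IsObservable A (concatSensors c))
    (hτ : τ ∈ nonAliasingPeriods A) {R : Fin r → Fin N} (hR : Function.Surjective R)
    (h : ∀ k < n + 1, ∀ l : Fin r, (c (R l))ᵀ *ᵥ (NormedSpace.exp ((τ / r) • A) ^ (l + 1 : ℕ) *ᵥ
      ((NormedSpace.exp ((τ / r) • A) ^ r) ^ k *ᵥ v)) = 0) : v = 0 := by
  rcases eq_or_ne r 0 with rfl | hr
  · exact eq_zero_of_observabilityMatrix_mulVec_eq_zero hobs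
      (funext fun ⟨_, i, _⟩ => isEmptyElim (hR i).choose)
  have hexp : NormedSpace.exp ((τ / r) • A) ^ r = NormedSpace.exp (τ • A) := by
    rw [← Matrix.exp_nsmul, ← Nat.cast_smul_eq_nsmul ℝ, smul_smul,
      mul_div_cancel₀ _ (Nat.cast_ne_zero.mpr hr)]
  choose slot hslot using hR
  refine eq_zero_of_forall_sampled hobs hτ (τ / r) (fun i => slot i + 1) fun i k => ?_
  refine mulVec_pow_mulVec_eq_zero (fun k hk => ?_) k
  rw [← mulVec_mulVec, ← hexp]
  simpa only [hslot] using h k (by simpa [Nat.lt_succ_iff] using hk) (slot i)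

lemma surjective_of_mem_strategySet {rmin : ℕ} (hrmin : 0 < rmin) {R : Fin r → Fin N}
    (hR : R ∈ strategySet N r rmin) : Function.Surjective R := fun i => by
  obtain ⟨l, hl⟩ := Finset.card_pos.mp (hrmin.trans_le (hR i))
  exact ⟨l, (Finset.mem_filter.mp hl).2⟩

end Observable

end SampledEstimation

theorem mainTheorem5 {n m p N r : ℕ}
    (A : Matrix (Fin n) (Fin n) ℝ) (G : Matrix (Fin n) (Fin m) ℝ)
    (c : Fin N → Matrix (Fin n) (Fin p) ℝ)
    (hobs : SampledEstimation.IsObservable A (SampledEstimation.concatSensors c))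
    (rmin : ℕ) (hrmin : 0 < rmin)
    (R : Fin r → Fin N) (hR : R ∈ SampledEstimation.strategySet N r rmin)
    (τ : ℝ) (hτ : τ ∈ SampledEstimation.nonAliasingPeriods A) :
    ∃ Slim : Matrix (Fin n) (Fin n) ℝ, ∀ S₀ : Matrix (Fin n) (Fin n) ℝ,
      S₀.PosSemidef → IsUnit (SampledEstimation.predictCov A G (τ / r) S₀) →
        Tendsto (fun k : ℕ => (SampledEstimation.periodUpdate A G c τ R)^[k] S₀) atTop
          (𝓝 Slim) := by
  have hsurj := SampledEstimation.surjective_of_mem_strategySet hrmin hR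
  have hperiod := SampledEstimation.isFilterUpdate_periodUpdate (A := A) (G := G) c R hτ.1.le
  obtain ⟨P, hP⟩ := hperiod.exists_tendsto_iterate_of_iterate n.succ_ne_zero fun v hv =>
    SampledEstimation.eq_zero_of_forall_period hobs hτ hsurj hv
  refine ⟨P, fun S₀ hS₀ hunit => (tendsto_add_atTop_iff_nat 1).mp ?_⟩
  exact hP _ (SampledEstimation.posDef_periodUpdate c R hτ.1.le hS₀ hunit)
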